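/- Let $n\ge 2$, let $H_0\in\mathbb C^{n\times n}$ be Hermitian and $V_1,\dots,V_r\in\mathbb C^{n\times n}$ arbitrary, and let $-L$ be the Kossakowski--Lindblad generator given by $$L(\rho)=\mathrm i[H_0,\rho]+\sum_{k=1}^r\Big(\tfrac12(V_k^*V_k\rho+\rho V_k^*V_k)-V_k\rho V_k^*\Big).$$ For $U\in\mathrm{SU}(n)$ let $-L_U$ be the linear map on $\mathbb R^n$ sending $\lambda$ to the vector of diagonal entries of $-U^*L(U\,\mathrm{diag}(\lambda)\,U^*)U$, and let $J(U)$ be the matrix with entries $J(U)_{ij}=\sum_{k=1}^r|(U^*V_kU)_{ij}|^2$. Let $\Delta^{n-1}\subset\mathbb R^n$ be the standard simplex. The reduced control system is $\dot\lambda(t)=-L_{U(t)}\lambda(t)$ on $\Delta^{n-1}$ with controls $U(t)\in\mathrm{SU}(n)$. It is called directly accessible at $\lambda\in\Delta^{n-1}$ if the vectors $-L_U\lambda$, $U\in\mathrm{SU}(n)$, span $\{v\in\mathbb R^n:\sum_i v_i=0\}$; generically directly accessible if it is directly accessible at every point of some relatively open, dense subset of $\Delta^{n-1}$ of full ($(n-1)$-dimensional)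 measure; and nowhere directly accessible if it is directly accessible at no point of $\Delta^{n-1}$. The generator $-L$ is called unital if $L(\mathbb 1)=0$, and purely Hamiltonian if $L=\mathrm i[H,\cdot\,]$ for some Hermitian $H$. Assume that $-L$ is unital. If $n=2$, then the reduced control system is generically directly accessible if and only if $-L$ is not purely Hamiltonian. If $n>2$, then exactly one of the following holds: 1. The reduced control system is generically directly accessible. 2. The reduced control system is nowhere directly accessible and, for every $U\in\mathrm{SU}(n)$, all off-diagonal entries of $J(U)$ are equal to each other. -/

import Mathlib

open scoped Matrix MeasureTheory

noncomputable section

namespace GKSL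

variable {n : ℕ}

/-- The superoperator `ad_H (ρ) = H ρ - ρ H`. -/
def adMap (H : Matrix (Fin n) (Fin n) ℂ) :
    Matrix (Fin n) (Fin n) ℂ →ₗ[ℂ] Matrix (Fin n) (Fin n) ℂ :=
  LinearMap.mulLeft ℂ H - LinearMap.mulRight ℂ H

/-- The dissipator `Γ_V (ρ) = (V* V ρ + ρ V* V) / 2 - V ρ V*`. -/
def dissipator (V : Matrix (Fin n) (Fin n) ℂ) :
    Matrix (Fin n) (Fin n) ℂ →ₗ[ℂ] Matrix (Fin n) (Fin n) ℂ :=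
  (1 / 2 : ℂ) • (LinearMap.mulLeft ℂ (Vᴴ * V) + LinearMap.mulRight ℂ (Vᴴ * V))
    - LinearMap.mulLeft ℂ V ∘ₗ LinearMap.mulRight ℂ Vᴴ

/-- The map `L = i ad_{H₀} + ∑ₖ Γ_{Vₖ}`; the Kossakowski–Lindblad generator is `-L`. -/
def lindblad {r : ℕ} (H₀ : Matrix (Fin n) (Fin n) ℂ) (V : Fin r → Matrix (Fin n) (Fin n) ℂ) :
    Matrix (Fin n) (Fin n) ℂ →ₗ[ℂ] Matrix (Fin n) (Fin n) ℂ :=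
  Complex.I • adMap H₀ + ∑ k, dissipator (V k)

/-- `-L` is unital if `L` annihilates the identity matrix. -/
def IsUnital (L : Matrix (Fin n) (Fin n) ℂ →ₗ[ℂ] Matrix (Fin n) (Fin n) ℂ) : Prop :=
  L 1 = 0

/-- `-L` is purely Hamiltonian if `L = i ad_H` for some Hermitian matrix `H`. -/
def IsPurelyHamiltonian (L : Matrix (Fin n) (Fin n) ℂ →ₗ[ℂ] Matrix (Fin n) (Fin n) ℂ) : Prop :=
  ∃ H : Matrix (Fin n) (Fin n) ℂ, H.IsHermitian ∧ L = Complex.I • adMap H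

/-- The value at `x` of the induced vector field `-L_U = -Π_diag ∘ Ad_U⁻¹ ∘ L ∘ Ad_U ∘ diag`.
For a Kossakowski–Lindblad generator the matrix `U* L(U diag(x) U*) U` is Hermitian, so its
diagonal is real and passing to the real part only changes the type of the entries. -/
def inducedField (L : Matrix (Fin n) (Fin n) ℂ →ₗ[ℂ] Matrix (Fin n) (Fin n) ℂ)
    (U : Matrix (Fin n) (Fin n) ℂ) (x : Fin n → ℝ) : Fin n → ℝ :=
  fun i => -((Uᴴ * L (U * Matrix.diagonal (fun j => (x j : ℂ)) * Uᴴ) * U) i i).re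

/-- `J(U) = ∑ₖ (U* Vₖ U) ∘ conj (U* Vₖ U)` (Hadamard product), that is,
`J(U)ᵢⱼ = ∑ₖ |(U* Vₖ U)ᵢⱼ|²`. -/
def rateMatrix {r : ℕ} (V : Fin r → Matrix (Fin n) (Fin n) ℂ)
    (U : Matrix (Fin n) (Fin n) ℂ) : Matrix (Fin n) (Fin n) ℝ :=
  Matrix.of fun i j => ∑ k, ‖(Uᴴ * V k * U) i j‖ ^ 2

/-- The set of achievable derivatives `{-L_U x : U ∈ SU(n)}`: the reduced control system on the
standard simplex is the differential inclusion `x'(t) ∈ derv L (x t)`. -/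
def derv (L : Matrix (Fin n) (Fin n) ℂ →ₗ[ℂ] Matrix (Fin n) (Fin n) ℂ) (x : Fin n → ℝ) :
    Set (Fin n → ℝ) :=
  {v | ∃ U ∈ Matrix.specialUnitaryGroup (Fin n) ℂ, v = inducedField L U x}

/-- The reduced control system is directly accessible at `x` if the achievable derivatives at `x`
span the hyperplane of vectors with vanishing coordinate sum. -/
def DirectlyAccessibleAt (L : Matrix (Fin n) (Fin n) ℂ →ₗ[ℂ] Matrix (Fin n) (Fin n) ℂ)
    (x : Fin n → ℝ) : Prop :=
  (Submodule.span ℝ (derv L x) : Set (Fin n → ℝ)) = {v | ∑ i, v i = 0}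

/-- A property holds generically on the standard simplex if it holds on a (relatively) open, dense
subset of full measure, i.e. whose complement in the simplex is a null set for the
`(n-1)`-dimensional Hausdorff measure of Euclidean space (on the simplex this is a constant
multiple of the `(n-1)`-dimensional Lebesgue measure). -/
def HoldsGenerically (P : stdSimplex ℝ (Fin n) → Prop) : Prop :=
  ∃ S : Set (stdSimplex ℝ (Fin n)), IsOpen S ∧ Dense S ∧
    μH[(n : ℝ) - 1]
      ((fun x : stdSimplex ℝ (Fin n) =>
        (WithLp.toLp 2 (x : Fin n → ℝ) : EuclideanSpace ℝ (Fin n))) '' Sᶜ) = 0 ∧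
    ∀ x ∈ S, P x

def GenericallyDirectlyAccessible
    (L : Matrix (Fin n) (Fin n) ℂ →ₗ[ℂ] Matrix (Fin n) (Fin n) ℂ) : Prop :=
  HoldsGenerically fun x : stdSimplex ℝ (Fin n) => DirectlyAccessibleAt L (x : Fin n → ℝ)

def NowhereDirectlyAccessible
    (L : Matrix (Fin n) (Fin n) ℂ →ₗ[ℂ] Matrix (Fin n) (Fin n) ℂ) : Prop :=
  ∀ x ∈ stdSimplex ℝ (Fin n), ¬ DirectlyAccessibleAt L x

/-- All entries off the diagonal are equal to each other. -/
def HasIdenticalOffDiagonal (J : Matrix (Fin n) (Fin n) ℝ) : Prop :=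
  ∀ i j k l : Fin n, i ≠ j → k ≠ l → J i j = J k l

end GKSL

end

/-! The diagonal of a commutator with a diagonal matrix vanishes, so `-L_U` is a classical master
equation with jump rates `J(U)`. At the vertex `e_j` the derivative is column `j` of `J(U)` off `j`,
with the entry at `j` making the sum zero. Permuting the columns of `U` permutes this derivative, so
two distinct off-diagonal entries in one column already give accessibility at `e_j`
(`directlyAccessibleAt_single_of_rateMatrix_ne`). Accessibility at one point is the non-vanishing of
a determinant polynomial in the state, hence generic
(`GenericallyDirectlyAccessible.of_directlyAccessibleAt`).

Otherwise each column of every `J(U)` is constant off the diagonal. Unitality equates row sums and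
column sums, which makes these constants equal; all derivatives at a state are then parallel, too
few for a hyperplane of dimension at least 2. For `n = 2` one nonzero derivative suffices, and if
there is none at any vertex, every `V k` is scalar. -/

namespace GKSL

open MeasureTheory Set Polynomial

/-! ### Generic properties -/

/-- A measurable set meeting every line through a point `p` in finitely many points is null. -/
theorem addHaar_eq_zero_of_finite_lines {E : Type*} [NormedAddCommGroup E] [NormedSpace ℝ E]
    [FiniteDimensional ℝ E] [MeasurableSpace E] [BorelSpace E] (μ : Measure E)
    [μ.IsAddHaarMeasure] {A : Set E} (hA : MeasurableSet A) (p : E)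
    (h : ∀ x, {t : ℝ | AffineMap.homothety p t x ∈ A}.Finite) : μ A = 0 := by
  have hmeas : MeasurableSet {z : E × ℝ | AffineMap.homothety p z.2 z.1 ∈ A} := by
    have : Continuous fun z : E × ℝ => AffineMap.homothety p z.2 z.1 := by
      simp only [AffineMap.homothety_apply, vsub_eq_sub, vadd_eq_add]
      fun_prop
    exact this.measurable hA
  -- Fubini, used both ways: the slices in `t` are finite, hence null, so for almost every `t` the
  -- slice in `x` is null.
  have h1 : (μ.prod (volume : Measure ℝ)) {z : E × ℝ | AffineMap.homothety p z.2 z.1 ∈ A} = 0 := by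
    rw [Measure.measure_prod_null hmeas]
    exact Filter.Eventually.of_forall fun x => (h x).measure_zero _
  have h2 : ((volume : Measure ℝ).prod μ)
      {z : ℝ × E | AffineMap.homothety p z.1 z.2 ∈ A} = 0 := by
    rw [← Measure.prod_swap, Measure.map_apply measurable_swap]
    · exact h1
    · exact measurable_swap hmeas
  have h3 := Measure.measure_ae_null_of_prod_null h2
  have h4 : ∀ᵐ t : ℝ, t ≠ 0 := by
    rw [ae_iff]
    simp
  obtain ⟨t, ht, ht0⟩ := (h3.and h4).exists
  have h5 : AffineMap.homothety p t '' {x | AffineMap.homothety p t x ∈ A} = A := by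
    ext y
    constructor
    · rintro ⟨x, hx, rfl⟩
      exact hx
    · intro hy
      have : AffineMap.homothety p t (AffineMap.homothety p t⁻¹ y) = y := by
        simp [AffineMap.homothety_apply, smul_smul, ht0]
      exact ⟨AffineMap.homothety p t⁻¹ y, by simpa [this] using hy, this⟩
  rw [← h5, Measure.addHaar_image_homothety]
  have : μ {x | AffineMap.homothety p t x ∈ A} = 0 := ht
  rw [this, mul_zero]

/-- Barycentric parametrization of the hyperplane `∑ xᵢ = 1` by its last `m` coordinates. -/
noncomputable def hyperplaneParam (m : ℕ) (y : Fin m → ℝ) : Fin (m + 1) → ℝ :=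
  Fin.cons (1 - ∑ i, y i) y

theorem hyperplaneParam_tail {m : ℕ} {x : Fin (m + 1) → ℝ} (hx : ∑ i, x i = 1) :
    hyperplaneParam m (Fin.tail x) = x := by
  rw [Fin.sum_univ_succ] at hx
  ext i
  refine Fin.cases ?_ (fun i => ?_) i
  · simp [hyperplaneParam, Fin.tail, ← hx]
  · simp [hyperplaneParam, Fin.tail]

theorem hyperplaneParam_homothety {m : ℕ} (p x : Fin m → ℝ) (t : ℝ) :
    hyperplaneParam m (AffineMap.homothety p t x) =
      AffineMap.homothety (hyperplaneParam m p) t (hyperplaneParam m x) := by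
  ext i
  refine Fin.cases ?_ (fun i => ?_) i
  · simp [hyperplaneParam, AffineMap.homothety_apply, Finset.sum_add_distrib,
      ← Finset.mul_sum]
    ring
  · simp [hyperplaneParam, AffineMap.homothety_apply]

/-- Lipschitz maps preserve Hausdorff-null sets, so Lebesgue-null sets in the chart give null sets
in the simplex. -/
theorem exists_lipschitzWith_toLp_hyperplaneParam (m : ℕ) :
    ∃ K, LipschitzWith K fun y : Fin m → ℝ =>
      (WithLp.toLp 2 (hyperplaneParam m y) : EuclideanSpace ℝ (Fin (m + 1))) := by
  let T : (Fin m → ℝ) →ₗ[ℝ] EuclideanSpace ℝ (Fin (m + 1)) :=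
    { toFun := fun y => WithLp.toLp 2 (Fin.cons (-∑ i, y i) y)
      map_add' := fun x y => by
        ext i
        refine Fin.cases ?_ (fun i => ?_) i
        · simp [Finset.sum_add_distrib]
          ring
        · simp
      map_smul' := fun c y => by
        ext i
        refine Fin.cases ?_ (fun i => ?_) i
        · simp [← Finset.mul_sum]
        · simp }
  refine ⟨‖LinearMap.toContinuousLinearMap T‖₊, LipschitzWith.of_dist_le_mul fun x y => ?_⟩
  have key : ∀ y, (WithLp.toLp 2 (hyperplaneParam m y) : EuclideanSpace ℝ (Fin (m + 1))) =
      T y + WithLp.toLp 2 (Fin.cons 1 0) := by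
    intro y
    ext i
    refine Fin.cases ?_ (fun i => ?_) i
    · simp [hyperplaneParam, T]
      ring
    · simp [hyperplaneParam, T]
  rw [key, key, dist_add_right]
  exact (LinearMap.toContinuousLinearMap T).lipschitz.dist_le_mul x y

/-- A function whose restriction to every line is polynomial. -/
def IsPolynomialOnLines {n : ℕ} (q : (Fin n → ℝ) → ℝ) : Prop :=
  ∀ p x : Fin n → ℝ, ∃ P : ℝ[X], ∀ t : ℝ, q (AffineMap.homothety p t x) = P.eval t

theorem IsPolynomialOnLines.finite_zeros {n : ℕ} {q : (Fin n → ℝ) → ℝ}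
    (hq : IsPolynomialOnLines q) {p : Fin n → ℝ} (hp : q p ≠ 0) (x : Fin n → ℝ) :
    {t : ℝ | q (AffineMap.homothety p t x) = 0}.Finite := by
  obtain ⟨P, hP⟩ := hq p x
  have hP0 : P ≠ 0 := by
    rintro rfl
    apply hp
    simpa using hP 0
  refine (Polynomial.finite_setOfPred_isRoot hP0).subset fun t ht => ?_
  simpa [Polynomial.IsRoot, ← hP] using ht

/-- Lines through `p` meet the zero set of `q` in finitely many points. Density follows by
approaching `x` along the segment from `p`, nullity by `addHaar_eq_zero_of_finite_lines` in the
chart. -/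
theorem HoldsGenerically.of_isPolynomialOnLines {n : ℕ} {P : stdSimplex ℝ (Fin n) → Prop}
    {q : (Fin n → ℝ) → ℝ} (hqc : Continuous q) (hq : IsPolynomialOnLines q)
    {p : Fin n → ℝ} (hp : p ∈ stdSimplex ℝ (Fin n)) (hqp : q p ≠ 0)
    (hP : ∀ x : stdSimplex ℝ (Fin n), q x.1 ≠ 0 → P x) : HoldsGenerically P := by
  refine ⟨{x | q x.1 ≠ 0}, ?_, ?_, ?_, hP⟩
  · exact isOpen_ne_fun (hqc.comp continuous_subtype_val) continuous_const
  · intro x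
    have hfin := hq.finite_zeros hqp x.1
    have hmem : ∀ t ∈ Icc (0 : ℝ) 1,
        AffineMap.homothety p t x.1 ∈ stdSimplex ℝ (Fin n) := by
      intro t ht
      rw [AffineMap.homothety_eq_lineMap]
      exact (convex_stdSimplex ℝ (Fin n)).lineMap_mem hp x.2 ht
    let γ : Icc (0 : ℝ) 1 → stdSimplex ℝ (Fin n) := fun t => ⟨_, hmem t t.2⟩
    have hγ : Continuous γ := by
      refine Continuous.subtype_mk ?_ _
      simp only [AffineMap.homothety_apply, vsub_eq_sub, vadd_eq_add]
      fun_prop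
    have hdense : Dense ({t : ℝ | q (AffineMap.homothety p t x.1) = 0}ᶜ) :=
      hfin.countable.dense_compl ℝ
    have h1 : (1 : ℝ) ∈ closure
        (Ioo (0 : ℝ) 1 ∩ {t : ℝ | q (AffineMap.homothety p t x.1) = 0}ᶜ) := by
      refine closure_minimal (hdense.open_subset_closure_inter isOpen_Ioo) isClosed_closure ?_
      rw [closure_Ioo (by norm_num)]
      simp
    rw [mem_closure_iff_seq_limit] at h1 ⊢
    obtain ⟨s, hs, hs1⟩ := h1
    refine ⟨fun k => γ ⟨s k, (hs k).1.1.le, (hs k).1.2.le⟩, fun k => (hs k).2, ?_⟩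
    have hx : γ ⟨1, by simp⟩ = x := Subtype.ext (by simp [γ])
    have hγ1 := hγ.tendsto ⟨1, by simp⟩
    rw [hx] at hγ1
    refine hγ1.comp ?_
    rw [tendsto_subtype_rng]
    exact hs1
  · obtain _ | m := n
    · simp [stdSimplex] at hp
    obtain ⟨K, hK⟩ := exists_lipschitzWith_toLp_hyperplaneParam m
    have hcont : Continuous (hyperplaneParam m) := by
      unfold hyperplaneParam
      fun_prop
    have hnull : volume {y : Fin m → ℝ | q (hyperplaneParam m y) = 0} = 0 := by
      refine addHaar_eq_zero_of_finite_lines volume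
        ((isClosed_eq (hqc.comp hcont) continuous_const).measurableSet) (Fin.tail p) fun x => ?_
      simp only [mem_ofPred_eq, hyperplaneParam_homothety, hyperplaneParam_tail hp.2]
      exact hq.finite_zeros hqp _
    have hle := hK.hausdorffMeasure_image_le (d := (m : ℝ)) (by positivity)
      {y : Fin m → ℝ | q (hyperplaneParam m y) = 0}
    have hvol : (μH[(m : ℝ)] : Measure (Fin m → ℝ)) = volume := by
      simpa using hausdorffMeasure_pi_real (ι := Fin m)
    rw [hvol, hnull, mul_zero, nonpos_iff_eq_zero] at hle
    have hm : ((m + 1 : ℕ) : ℝ) - 1 = m := by simp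
    rw [hm]
    refine measure_mono_null ?_ hle
    rintro _ ⟨x, hx, rfl⟩
    have hx0 : q x.1 = 0 := by simpa using hx
    exact ⟨Fin.tail x.1, by simpa [hyperplaneParam_tail x.2.2] using hx0,
      congrArg (WithLp.toLp 2) (hyperplaneParam_tail x.2.2)⟩

theorem isPolynomialOnLines_det {n : ℕ} {f : Fin n → (Fin n → ℝ) → Fin n → ℝ}
    (hf : ∀ a (p x : Fin n → ℝ) (t : ℝ), f a (AffineMap.homothety p t x) = AffineMap.homothety (f a p) t (f a x)) :
    IsPolynomialOnLines fun x => (Matrix.of fun a => f a x).det := by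
  intro p x
  refine ⟨(Matrix.of fun a b => X * C (f a x b - f a p b) + C (f a p b)).det, fun t => ?_⟩
  rw [← Polynomial.coe_evalRingHom, RingHom.map_det]
  refine congrArg Matrix.det ?_
  ext a b
  simp only [hf]
  simp [AffineMap.homothety_apply]

theorem HoldsGenerically.exists {n : ℕ} {P : stdSimplex ℝ (Fin n) → Prop} (hn : n ≠ 0)
    (h : HoldsGenerically P) : ∃ x, P x := by
  obtain ⟨S, -, hS, -, hP⟩ := h
  have : Nonempty (stdSimplex ℝ (Fin n)) :=
    ⟨⟨_, single_mem_stdSimplex ℝ (⟨0, Nat.pos_of_ne_zero hn⟩ : Fin n)⟩⟩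
  obtain ⟨x, hx⟩ := hS.nonempty
  exact ⟨x, hP x hx⟩

end GKSL

namespace GKSL

open Finset

variable {n r : ℕ}

/-! ### The reduced control system -/

/-- Conjugation by `U` replaces `V` by `W = U* V U`; the anticommutator then contributes column sums
of `|W|²`, the sandwich term the rows. -/
theorem dissipator_conj_diag {V U : Matrix (Fin n) (Fin n) ℂ} (hU : Uᴴ * U = 1)
    (x : Fin n → ℝ) (i : Fin n) :
    (Uᴴ * dissipator V (U * Matrix.diagonal (fun j => (x j : ℂ)) * Uᴴ) * U) i i =
      (((∑ j, ‖(Uᴴ * V * U) j i‖ ^ 2) * x i - ∑ j, ‖(Uᴴ * V * U) i j‖ ^ 2 * x j : ℝ) : ℂ) := by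
  set D := Matrix.diagonal (fun j => (x j : ℂ)) with hD
  have hU' : U * Uᴴ = 1 := mul_eq_one_comm.mp hU
  set W := Uᴴ * V * U with hW
  have hWH : Wᴴ = Uᴴ * Vᴴ * U := by
    simp [hW, Matrix.conjTranspose_mul, Matrix.mul_assoc]
  have h1 : Wᴴ * W = Uᴴ * (Vᴴ * V) * U := by
    calc Wᴴ * W = Uᴴ * Vᴴ * (U * Uᴴ) * V * U := by rw [hWH, hW]; noncomm_ring
      _ = _ := by rw [hU']; noncomm_ring
  have key : Uᴴ * dissipator V (U * D * Uᴴ) * U =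
      (1 / 2 : ℂ) • (Wᴴ * W * D + D * (Wᴴ * W)) - W * D * Wᴴ := by
    have e1 : Uᴴ * dissipator V (U * D * Uᴴ) * U =
        (1 / 2 : ℂ) • (Uᴴ * (Vᴴ * V) * U * D * (Uᴴ * U) + (Uᴴ * U) * D * (Uᴴ * (Vᴴ * V) * U)) -
          (Uᴴ * V * U) * D * (Uᴴ * Vᴴ * U) := by
      simp only [dissipator, LinearMap.sub_apply, LinearMap.smul_apply, LinearMap.add_apply,
        LinearMap.comp_apply, LinearMap.mulLeft_apply, LinearMap.mulRight_apply,
        Matrix.mul_sub, Matrix.sub_mul, Matrix.mul_smul, Matrix.smul_mul, Matrix.mul_add,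
        Matrix.add_mul, Matrix.mul_assoc]
    rw [e1, hU, h1, ← hWH, Matrix.mul_one, Matrix.one_mul]
  rw [key]
  have hn : ∀ z : ℂ, z * star z = ((‖z‖ ^ 2 : ℝ) : ℂ) := by
    intro z
    simpa using Complex.mul_conj' z
  have h2 : (Wᴴ * W) i i = ((∑ j, ‖W j i‖ ^ 2 : ℝ) : ℂ) := by
    rw [Matrix.mul_apply, Complex.ofReal_sum]
    refine sum_congr rfl fun j _ => ?_
    rw [Matrix.conjTranspose_apply, mul_comm, hn]
  have h3 : (W * D * Wᴴ) i i = ((∑ j, ‖W i j‖ ^ 2 * x j : ℝ) : ℂ) := by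
    rw [Matrix.mul_apply, Complex.ofReal_sum]
    refine sum_congr rfl fun j _ => ?_
    rw [hD, Matrix.mul_diagonal, Matrix.conjTranspose_apply, Complex.ofReal_mul, ← hn]
    ring
  rw [Matrix.sub_apply, Matrix.smul_apply, Matrix.add_apply, h3, hD, Matrix.mul_diagonal,
    Matrix.diagonal_mul, h2, smul_eq_mul]
  push_cast
  ring

theorem adMap_conj_diag (H : Matrix (Fin n) (Fin n) ℂ) {U : Matrix (Fin n) (Fin n) ℂ}
    (hU : Uᴴ * U = 1) (x : Fin n → ℝ) (i : Fin n) :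
    (Uᴴ * adMap H (U * Matrix.diagonal (fun j => (x j : ℂ)) * Uᴴ) * U) i i = 0 := by
  set D := Matrix.diagonal (fun j => (x j : ℂ)) with hD
  have key : Uᴴ * adMap H (U * D * Uᴴ) * U = (Uᴴ * H * U) * D - D * (Uᴴ * H * U) := by
    have e1 : Uᴴ * adMap H (U * D * Uᴴ) * U =
        (Uᴴ * H * U) * D * (Uᴴ * U) - (Uᴴ * U) * D * (Uᴴ * H * U) := by
      simp only [adMap, LinearMap.sub_apply, LinearMap.mulLeft_apply, LinearMap.mulRight_apply,
        Matrix.mul_sub, Matrix.sub_mul, Matrix.mul_assoc]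
    rw [e1, hU, Matrix.mul_one, Matrix.one_mul]
  rw [key, Matrix.sub_apply, hD, Matrix.mul_diagonal, Matrix.diagonal_mul]
  ring

theorem conjTranspose_mul_self_of_mem {U : Matrix (Fin n) (Fin n) ℂ}
    (hU : U ∈ Matrix.specialUnitaryGroup (Fin n) ℂ) : Uᴴ * U = 1 :=
  Matrix.mem_unitaryGroup_iff'.mp (Matrix.mem_specialUnitaryGroup_iff.mp hU).1

theorem inducedField_lindblad (H : Matrix (Fin n) (Fin n) ℂ)
    (V : Fin r → Matrix (Fin n) (Fin n) ℂ) {U : Matrix (Fin n) (Fin n) ℂ}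
    (hU : U ∈ Matrix.specialUnitaryGroup (Fin n) ℂ) (x : Fin n → ℝ) (i : Fin n) :
    inducedField (lindblad H V) U x i =
      ∑ j, rateMatrix V U i j * x j - (∑ j, rateMatrix V U j i) * x i := by
  have hU1 := conjTranspose_mul_self_of_mem hU
  have e : Uᴴ * lindblad H V (U * Matrix.diagonal (fun j => (x j : ℂ)) * Uᴴ) * U =
      Complex.I • (Uᴴ * adMap H (U * Matrix.diagonal (fun j => (x j : ℂ)) * Uᴴ) * U) +
      ∑ k, Uᴴ * dissipator (V k) (U * Matrix.diagonal (fun j => (x j : ℂ)) * Uᴴ) * U := by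
    simp only [lindblad, LinearMap.add_apply, LinearMap.smul_apply, LinearMap.sum_apply,
      Matrix.mul_add, Matrix.add_mul, Matrix.mul_smul, Matrix.smul_mul, Matrix.mul_sum,
      Matrix.sum_mul]
  rw [inducedField, e, Matrix.add_apply, Matrix.smul_apply, adMap_conj_diag H hU1, smul_zero,
    zero_add, Matrix.sum_apply]
  simp only [dissipator_conj_diag hU1, ← Complex.ofReal_sum, Complex.ofReal_re, rateMatrix,
    Matrix.of_apply, sum_sub_distrib, sum_mul]
  rw [neg_sub, sum_comm (γ := Fin r), sum_comm (γ := Fin r)]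

theorem sum_inducedField (H : Matrix (Fin n) (Fin n) ℂ)
    (V : Fin r → Matrix (Fin n) (Fin n) ℂ) {U : Matrix (Fin n) (Fin n) ℂ}
    (hU : U ∈ Matrix.specialUnitaryGroup (Fin n) ℂ) (x : Fin n → ℝ) :
    ∑ i, inducedField (lindblad H V) U x i = 0 := by
  simp only [inducedField_lindblad H V hU, sum_sub_distrib, sum_mul]
  rw [sum_comm, sub_self]

theorem inducedField_homothety (H : Matrix (Fin n) (Fin n) ℂ)
    (V : Fin r → Matrix (Fin n) (Fin n) ℂ) {U : Matrix (Fin n) (Fin n) ℂ}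
    (hU : U ∈ Matrix.specialUnitaryGroup (Fin n) ℂ) (p x : Fin n → ℝ) (t : ℝ) :
    inducedField (lindblad H V) U (AffineMap.homothety p t x) =
      AffineMap.homothety (inducedField (lindblad H V) U p) t
        (inducedField (lindblad H V) U x) := by
  ext i
  simp only [inducedField_lindblad H V hU, AffineMap.homothety_apply, vsub_eq_sub, vadd_eq_add,
    Pi.add_apply, Pi.smul_apply, Pi.sub_apply, smul_eq_mul, mul_add, sum_add_distrib, mul_sub,
    sum_sub_distrib, mul_left_comm _ t, ← mul_sum]
  ring

theorem continuous_inducedField (H : Matrix (Fin n) (Fin n) ℂ)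
    (V : Fin r → Matrix (Fin n) (Fin n) ℂ) {U : Matrix (Fin n) (Fin n) ℂ}
    (hU : U ∈ Matrix.specialUnitaryGroup (Fin n) ℂ) :
    Continuous (inducedField (lindblad H V) U) := by
  refine continuous_pi fun i => ?_
  simp only [inducedField_lindblad H V hU]
  fun_prop

theorem sum_eq_zero_of_mem_span_derv (H : Matrix (Fin n) (Fin n) ℂ)
    (V : Fin r → Matrix (Fin n) (Fin n) ℂ) {x v : Fin n → ℝ}
    (hv : v ∈ Submodule.span ℝ (derv (lindblad H V) x)) : ∑ i, v i = 0 := by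
  induction hv using Submodule.span_induction with
  | mem v hv =>
    obtain ⟨U, hU, rfl⟩ := hv
    exact sum_inducedField H V hU x
  | zero => simp
  | add v w _ _ hv hw => simp [sum_add_distrib, hv, hw]
  | smul c v _ hv => simp [← mul_sum, hv]

theorem directlyAccessibleAt_iff (H : Matrix (Fin n) (Fin n) ℂ)
    (V : Fin r → Matrix (Fin n) (Fin n) ℂ) (x : Fin n → ℝ) :
    DirectlyAccessibleAt (lindblad H V) x ↔
      ∀ z : Fin n → ℝ, ∑ i, z i = 0 → z ∈ Submodule.span ℝ (derv (lindblad H V) x) := by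
  refine ⟨fun h z hz => ?_, fun h => Set.Subset.antisymm (fun v hv => ?_) h⟩
  · have : z ∈ (Submodule.span ℝ (derv (lindblad H V) x) : Set (Fin n → ℝ)) := by
      rw [h]
      exact hz
    exact this
  · exact sum_eq_zero_of_mem_span_derv H V hv

/-- The induced vector fields, together with the constant field `1` transverse to the simplex. -/
noncomputable def augmentedField (H : Matrix (Fin n) (Fin n) ℂ) (V : Fin r → Matrix (Fin n) (Fin n) ℂ) :
    Option (Matrix.specialUnitaryGroup (Fin n) ℂ) → (Fin n → ℝ) → Fin n → ℝ
  | none => 1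
  | some U => inducedField (lindblad H V) U

/-- The vector `1` has nonzero coordinate sum, so adjoining it turns spanning the hyperplane into
spanning the whole space, which `n × n` determinants detect. -/
theorem directlyAccessibleAt_iff_span_augmentedField (hn : n ≠ 0) (H : Matrix (Fin n) (Fin n) ℂ)
    (V : Fin r → Matrix (Fin n) (Fin n) ℂ) (x : Fin n → ℝ) :
    DirectlyAccessibleAt (lindblad H V) x ↔
      Submodule.span ℝ (Set.range fun a => augmentedField H V a x) = ⊤ := by
  have hn' : (n : ℝ) ≠ 0 := Nat.cast_ne_zero.mpr hn
  have hrange : (Set.range fun a => augmentedField H V a x) =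
      insert 1 (derv (lindblad H V) x) := by
    ext v
    simp only [Set.mem_range, Option.exists, augmentedField, derv, Set.mem_insert_iff,
      Set.mem_ofPred_eq, Subtype.exists, exists_prop, Pi.one_apply, eq_comm (a := v)]
  rw [hrange, directlyAccessibleAt_iff, Submodule.eq_top_iff']
  constructor
  · intro h z
    have hz : z = (z - ((∑ i, z i) / n) • (1 : Fin n → ℝ)) +
      ((∑ i, z i) / n) • (1 : Fin n → ℝ) := by simp
    rw [hz]
    refine Submodule.add_mem _ (Submodule.span_mono (Set.subset_insert _ _) (h _ ?_))
      (Submodule.smul_mem _ _ (Submodule.subset_span (Set.mem_insert _ _)))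
    simp [sum_sub_distrib, mul_div_cancel₀, hn']
  · intro h z hz
    obtain ⟨c, w, hw, rfl⟩ := Submodule.mem_span_insert.mp (h z)
    have hw0 := sum_eq_zero_of_mem_span_derv H V hw
    have hc : c = 0 := by simpa [sum_add_distrib, hw0, hn] using hz
    simpa [hc] using hw

theorem GenericallyDirectlyAccessible.of_directlyAccessibleAt (H : Matrix (Fin n) (Fin n) ℂ)
    (V : Fin r → Matrix (Fin n) (Fin n) ℂ) {p : Fin n → ℝ} (hp : p ∈ stdSimplex ℝ (Fin n))
    (h : DirectlyAccessibleAt (lindblad H V) p) :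
    GenericallyDirectlyAccessible (lindblad H V) := by
  have hn : n ≠ 0 := by
    rintro rfl
    simp [stdSimplex] at hp
  rw [directlyAccessibleAt_iff_span_augmentedField hn] at h
  -- Fix `n` fields independent at `p`; their determinant, as a function of the state, is the
  -- required `q`.
  obtain ⟨g, hg, -, hgi⟩ := Submodule.exists_fun_fin_finrank_span_eq ℝ
    (Set.range fun a => augmentedField H V a p)
  have hrank : n = Module.finrank ℝ
      (Submodule.span ℝ (Set.range fun a => augmentedField H V a p)) := by
    rw [h]
    simp
  choose a ha using hg
  let f : Fin n → (Fin n → ℝ) → Fin n → ℝ := fun i => augmentedField H V (a (finCongr hrank i))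
  have hfp : LinearIndependent ℝ fun i => f i p := by
    have : (fun i => f i p) = g ∘ finCongr hrank := funext fun i => ha _
    rw [this]
    exact hgi.comp _ (finCongr hrank).injective
  have hcont : ∀ i, Continuous (f i) := by
    intro i
    simp only [f]
    rcases a (finCongr hrank i) with _ | U
    · exact continuous_const
    · exact continuous_inducedField H V U.2
  refine HoldsGenerically.of_isPolynomialOnLines (q := fun x => (Matrix.of fun i => f i x).det)
    ?_ (isPolynomialOnLines_det fun i q x t => ?_) hp ?_ fun x hx => ?_
  · refine Continuous.matrix_det ?_
    exact continuous_pi hcont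
  · simp only [f]
    rcases a (finCongr hrank i) with _ | U
    · simp [augmentedField]
    · exact inducedField_homothety H V U.2 q x t
  · have := Matrix.linearIndependent_rows_iff_isUnit.mp
      (show LinearIndependent ℝ (Matrix.of fun i => f i p).row from hfp)
    exact ((Matrix.isUnit_iff_isUnit_det _).mp this).ne_zero
  · have hli : LinearIndependent ℝ fun i => f i x.1 :=
      Matrix.linearIndependent_rows_iff_isUnit.mpr
        ((Matrix.isUnit_iff_isUnit_det (Matrix.of fun i => f i x.1)).mpr hx.isUnit)
    have : Nonempty (Fin n) := ⟨⟨0, Nat.pos_of_ne_zero hn⟩⟩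
    refine (directlyAccessibleAt_iff_span_augmentedField hn H V x.1).mpr (top_unique ?_)
    rw [← hli.span_eq_top_of_card_eq_finrank (by simp)]
    refine Submodule.span_mono ?_
    rintro _ ⟨i, rfl⟩
    exact ⟨_, rfl⟩

end GKSL

namespace GKSL

open Finset

variable {n r : ℕ}

/-! ### Achievable derivatives at the vertices of the simplex -/

theorem inducedField_single (H : Matrix (Fin n) (Fin n) ℂ)
    (V : Fin r → Matrix (Fin n) (Fin n) ℂ) {U : Matrix (Fin n) (Fin n) ℂ}
    (hU : U ∈ Matrix.specialUnitaryGroup (Fin n) ℂ) {i j : Fin n} (hij : i ≠ j) :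
    inducedField (lindblad H V) U (Pi.single j 1) i = rateMatrix V U i j := by
  simp [inducedField_lindblad H V hU, Pi.single_apply, hij]

theorem inducedField_single_self (H : Matrix (Fin n) (Fin n) ℂ)
    (V : Fin r → Matrix (Fin n) (Fin n) ℂ) {U : Matrix (Fin n) (Fin n) ℂ}
    (hU : U ∈ Matrix.specialUnitaryGroup (Fin n) ℂ) (j : Fin n) :
    inducedField (lindblad H V) U (Pi.single j 1) j =
      -∑ i ∈ univ.erase j, rateMatrix V U i j := by
  rw [eq_neg_iff_add_eq_zero, ← sum_inducedField H V hU (Pi.single j 1),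
    ← add_sum_erase univ _ (mem_univ j)]
  congr 1
  exact sum_congr rfl fun i hi => (inducedField_single H V hU (ne_of_mem_erase hi)).symm

theorem rateMatrix_nonneg (V : Fin r → Matrix (Fin n) (Fin n) ℂ) (U : Matrix (Fin n) (Fin n) ℂ)
    (i j : Fin n) : 0 ≤ rateMatrix V U i j := by
  rw [rateMatrix, Matrix.of_apply]
  positivity

/-- Two columns of a special unitary matrix can be exchanged, up to a sign. -/
theorem exists_rateMatrix_swap (V : Fin r → Matrix (Fin n) (Fin n) ℂ)
    {U : Matrix (Fin n) (Fin n) ℂ} (hU : U ∈ Matrix.specialUnitaryGroup (Fin n) ℂ)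
    {a b : Fin n} (hab : a ≠ b) :
    ∃ U' ∈ Matrix.specialUnitaryGroup (Fin n) ℂ, ∀ i j,
      rateMatrix V U' i j = rateMatrix V U (Equiv.swap a b i) (Equiv.swap a b j) := by
  set σ := Equiv.swap a b
  -- The sign compensates the determinant of the transposition and is invisible to absolute values.
  let d : Fin n → ℂ := fun i => if i = a then -1 else 1
  have hd : ∀ i, ‖d i‖ = 1 := fun i => by by_cases h : i = a <;> simp [d, h]
  have hdd : ∀ i, star (d i) * d i = 1 := fun i => by by_cases h : i = a <;> simp [d, h]
  have hconj : ∀ M : Matrix (Fin n) (Fin n) ℂ,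
      ((U * Matrix.diagonal d).submatrix id σ)ᴴ * M * (U * Matrix.diagonal d).submatrix id σ =
        (Matrix.diagonal (star d) * (Uᴴ * M * U) * Matrix.diagonal d).submatrix σ σ := by
    intro M
    have e : Matrix.diagonal (star d) * (Uᴴ * M * U) * Matrix.diagonal d =
        (U * Matrix.diagonal d)ᴴ * M * (U * Matrix.diagonal d) := by
      rw [Matrix.conjTranspose_mul, Matrix.diagonal_conjTranspose]
      simp only [Matrix.mul_assoc]
    rw [e, Matrix.conjTranspose_submatrix]
    ext i j
    simp [Matrix.mul_apply, Matrix.submatrix_apply]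
  refine ⟨(U * Matrix.diagonal d).submatrix id σ, ?_, fun i j => ?_⟩
  · rw [Matrix.mem_specialUnitaryGroup_iff]
    constructor
    · rw [Matrix.mem_unitaryGroup_iff', Matrix.star_eq_conjTranspose]
      have := hconj 1
      rw [Matrix.mul_one, Matrix.mul_one, conjTranspose_mul_self_of_mem hU, Matrix.mul_one,
        Matrix.diagonal_mul_diagonal] at this
      rw [this]
      have h1 : (fun i => star d i * d i) = 1 := funext hdd
      rw [h1]
      exact Matrix.submatrix_one_equiv σ
    · rw [Matrix.det_permute', Matrix.det_mul, (Matrix.mem_specialUnitaryGroup_iff.mp hU).2,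
        Matrix.det_diagonal, Equiv.Perm.sign_swap hab]
      simp [d, prod_ite_eq']
  · simp only [rateMatrix, Matrix.of_apply]
    refine sum_congr rfl fun k _ => ?_
    rw [hconj, Matrix.submatrix_apply, Matrix.mul_diagonal, Matrix.diagonal_mul]
    simp [hd]

theorem sub_comp_swap {ι : Type*} [DecidableEq ι] (v : ι → ℝ) {a b : ι} (hab : a ≠ b) :
    v - v ∘ Equiv.swap a b = (v a - v b) • (Pi.single a 1 - Pi.single b 1) := by
  ext c
  by_cases hca : c = a
  · subst hca
    simp [hab]
  · by_cases hcb : c = b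
    · subst hcb
      simp [hca]
    · simp [hca, hcb, Equiv.swap_apply_of_ne_of_ne]

/-- A subspace containing all transpositions fixing `j` of a vector `v` with vanishing sum, two
distinct entries away from `j` and `v j ≠ 0` contains all vectors with vanishing sum. -/
theorem mem_of_comp_swap_mem {ι : Type*} [Fintype ι] [DecidableEq ι] {W : Submodule ℝ (ι → ℝ)}
    {v : ι → ℝ} {i j k : ι} (hv : v ∈ W)
    (hswap : ∀ a b, a ≠ b → a ≠ j → b ≠ j → v ∘ Equiv.swap a b ∈ W)
    (hij : i ≠ j) (hkj : k ≠ j) (hik : v i ≠ v k) (hvj : v j ≠ 0) (hsum : ∑ a, v a = 0)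
    {z : ι → ℝ} (hz : ∑ a, z a = 0) : z ∈ W := by
  have h1 : ∀ a b, a ≠ j → b ≠ j → v a ≠ v b →
      (Pi.single a 1 - Pi.single b 1 : ι → ℝ) ∈ W := by
    intro a b ha hb hab
    have hne : a ≠ b := fun h => hab (congrArg v h)
    have := W.sub_mem hv (hswap a b hne ha hb)
    rw [sub_comp_swap v hne] at this
    exact (W.smul_mem_iff (sub_ne_zero.mpr hab)).mp this
  have h2 : ∀ a, a ≠ j → (Pi.single a 1 - Pi.single i 1 : ι → ℝ) ∈ W := by
    intro a ha
    -- If `v a = v i`, the difference is reached through `k`, since then `v a ≠ v k`.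
    by_cases hai : v a = v i
    · have := W.sub_mem (h1 a k ha hkj (hai ▸ hik)) (h1 i k hij hkj hik)
      simpa using this
    · exact h1 a i ha hij hai
  have hdecomp : ∀ w : ι → ℝ, ∑ a, w a = 0 →
      w = ∑ a, w a • (Pi.single a 1 - Pi.single i 1 : ι → ℝ) := by
    intro w hw
    ext c
    simp [mul_sub, Pi.single_apply, hw]
  -- Expand `v` itself in these differences and solve for the term at `j`, using `v j ≠ 0`.
  have h3 : (Pi.single j 1 - Pi.single i 1 : ι → ℝ) ∈ W := by
    have e := hdecomp v hsum
    rw [← add_sum_erase univ _ (mem_univ j)] at e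
    refine (W.smul_mem_iff hvj).mp ?_
    rw [eq_sub_iff_add_eq.mpr e.symm]
    exact W.sub_mem hv (W.sum_mem fun a ha => W.smul_mem _ (h2 a (ne_of_mem_erase ha)))
  rw [hdecomp z hz]
  refine W.sum_mem fun a _ => W.smul_mem _ ?_
  by_cases ha : a = j
  · exact ha ▸ h3
  · exact h2 a ha

theorem directlyAccessibleAt_single_of_rateMatrix_ne (H : Matrix (Fin n) (Fin n) ℂ)
    (V : Fin r → Matrix (Fin n) (Fin n) ℂ) {U : Matrix (Fin n) (Fin n) ℂ}
    (hU : U ∈ Matrix.specialUnitaryGroup (Fin n) ℂ) {i j k : Fin n} (hij : i ≠ j) (hkj : k ≠ j)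
    (hik : rateMatrix V U i j ≠ rateMatrix V U k j) :
    DirectlyAccessibleAt (lindblad H V) (Pi.single j 1) := by
  rw [directlyAccessibleAt_iff]
  intro z hz
  refine mem_of_comp_swap_mem (v := inducedField (lindblad H V) U (Pi.single j 1))
    (i := i) (j := j) (k := k) ?_ (fun a b hab ha hb => ?_) hij hkj ?_ ?_
    (sum_inducedField H V hU _) hz
  · exact Submodule.subset_span ⟨U, hU, rfl⟩
  · obtain ⟨U', hU', hJ⟩ := exists_rateMatrix_swap V hU hab
    refine Submodule.subset_span ⟨U', hU', ?_⟩
    have hj : Equiv.swap a b j = j := Equiv.swap_apply_of_ne_of_ne ha.symm hb.symm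
    ext c
    simp only [Function.comp_apply, inducedField_lindblad H V hU, inducedField_lindblad H V hU', hJ]
    rw [Equiv.sum_comp (Equiv.swap a b) fun d => rateMatrix V U d (Equiv.swap a b c)]
    have hs : ∀ d, (Pi.single j 1 : Fin n → ℝ) (Equiv.swap a b d) =
        (Pi.single j 1 : Fin n → ℝ) d := by
      intro d
      simp only [Pi.single_apply, Equiv.swap_apply_eq_iff, hj]
    rw [hs, ← Equiv.sum_comp (Equiv.swap a b)
      fun d => rateMatrix V U (Equiv.swap a b c) d * (Pi.single j 1 : Fin n → ℝ) d]
    simp only [hs]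
  · rwa [inducedField_single H V hU hij, inducedField_single H V hU hkj]
  -- A zero entry at `j` would force all the nonnegative rates out of `j` to vanish, so none could
  -- differ.
  · rw [inducedField_single_self H V hU, neg_ne_zero]
    intro h0
    rw [sum_eq_zero_iff_of_nonneg fun a _ => rateMatrix_nonneg V U a j] at h0
    exact hik ((h0 i (by simp [hij])).trans (h0 k (by simp [hkj])).symm)

/-! ### Unital systems with constant columns -/

/-- The identity is fixed by conjugation, so the induced field vanishes at the vector `1`. -/
theorem sum_rateMatrix_comm_of_isUnital (H : Matrix (Fin n) (Fin n) ℂ)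
    (V : Fin r → Matrix (Fin n) (Fin n) ℂ) (hL : IsUnital (lindblad H V))
    {U : Matrix (Fin n) (Fin n) ℂ} (hU : U ∈ Matrix.specialUnitaryGroup (Fin n) ℂ) (i : Fin n) :
    ∑ j, rateMatrix V U i j = ∑ j, rateMatrix V U j i := by
  have hU1 : U * Uᴴ = 1 := mul_eq_one_comm.mp (conjTranspose_mul_self_of_mem hU)
  have h := inducedField_lindblad H V hU 1 i
  have h0 : inducedField (lindblad H V) U 1 i = 0 := by
    have : lindblad H V 1 = 0 := hL
    simp [inducedField, hU1, this]
  rw [h0] at h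
  simpa using (sub_eq_zero.mp h.symm)

/-- If `c j` is the value in column `j`, comparing row `i` with column `i` gives `∑_{j≠i} c j =
(n-1) c i`, so `n * c i` does not depend on `i`. -/
theorem hasIdenticalOffDiagonal_of_columns {J : Matrix (Fin n) (Fin n) ℝ}
    (hcol : ∀ i j k, i ≠ j → k ≠ j → J i j = J k j)
    (hsum : ∀ i, ∑ j, J i j = ∑ j, J j i) : HasIdenticalOffDiagonal J := by
  have hex : ∀ j : Fin n, ∃ c, ∀ i, i ≠ j → J i j = c := by
    intro j
    by_cases h : ∃ k, k ≠ j
    · obtain ⟨k, hk⟩ := h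
      exact ⟨J k j, fun i hi => hcol i j k hi hk⟩
    · exact ⟨0, fun i hi => (h ⟨i, hi⟩).elim⟩
  choose c hc using hex
  have hmean : ∀ i, n * c i = ∑ j, c j := by
    intro i
    have h := hsum i
    rw [← add_sum_erase univ _ (mem_univ i), ← add_sum_erase univ (fun j => J j i) (mem_univ i),
      add_right_inj, sum_congr rfl fun j hj => hc j i (ne_of_mem_erase hj).symm,
      sum_congr rfl fun j hj => hc i j (ne_of_mem_erase hj)] at h
    have h' : ∑ j, c j = ∑ _j : Fin n, c i := by
      rw [← add_sum_erase univ _ (mem_univ i), ← add_sum_erase univ (fun _ => c i) (mem_univ i), h]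
    simpa using h'.symm
  intro i j k l hij hkl
  rw [hc j i hij, hc l k hkl]
  have hn : (n : ℝ) ≠ 0 := Nat.cast_ne_zero.mpr (Fin.pos i).ne'
  exact mul_left_cancel₀ hn ((hmean j).trans (hmean l).symm)

theorem not_directlyAccessibleAt_of_hasIdenticalOffDiagonal (hn : 2 < n)
    (H : Matrix (Fin n) (Fin n) ℂ) (V : Fin r → Matrix (Fin n) (Fin n) ℂ)
    (hJ : ∀ U ∈ Matrix.specialUnitaryGroup (Fin n) ℂ, HasIdenticalOffDiagonal (rateMatrix V U))
    (x : Fin n → ℝ) : ¬ DirectlyAccessibleAt (lindblad H V) x := by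
  intro h
  rw [directlyAccessibleAt_iff] at h
  -- With all off-diagonal rates equal to `c`, the derivative is `c • w`, and `w` does not depend on
  -- `U`.
  let w : Fin n → ℝ := fun i => ∑ j, (x j - x i)
  have hw : Submodule.span ℝ (derv (lindblad H V) x) ≤ Submodule.span ℝ {w} := by
    rw [Submodule.span_le]
    rintro _ ⟨U, hU, rfl⟩
    refine Submodule.mem_span_singleton.mpr
      ⟨rateMatrix V U ⟨0, by omega⟩ ⟨1, by omega⟩, funext fun i => ?_⟩
    rw [inducedField_lindblad H V hU, sum_mul, ← sum_sub_distrib, Pi.smul_apply, smul_eq_mul,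
      mul_sum]
    refine sum_congr rfl fun j _ => ?_
    by_cases hij : i = j
    · simp [hij]
    · rw [hJ U hU i j ⟨0, by omega⟩ ⟨1, by omega⟩ hij (by simp),
        hJ U hU j i ⟨0, by omega⟩ ⟨1, by omega⟩ (Ne.symm hij) (by simp)]
      ring
  let i₀ : Fin n := ⟨0, by omega⟩
  let i₁ : Fin n := ⟨1, by omega⟩
  let i₂ : Fin n := ⟨2, by omega⟩
  have h01 : i₀ ≠ i₁ := by simp [i₀, i₁]
  have h02 : i₀ ≠ i₂ := by simp [i₀, i₂]
  have h12 : i₁ ≠ i₂ := by simp [i₁, i₂]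
  have hmem : ∀ a b : Fin n,
      ∃ c : ℝ, c • w = (Pi.single a 1 - Pi.single b 1 : Fin n → ℝ) := fun a b =>
    Submodule.mem_span_singleton.mp (hw (h _ (by simp [sum_sub_distrib])))
  -- Coordinate `i₂` of the first relation forces `c = 0` or `w i₂ = 0`; each contradicts one of the
  -- two relations.
  obtain ⟨c, hc⟩ := hmem i₀ i₁
  obtain ⟨d, hd⟩ := hmem i₀ i₂
  have hc0 := congrFun hc i₀
  have hc2 := congrFun hc i₂
  have hd2 := congrFun hd i₂
  simp [h01, h02.symm, h12.symm] at hc0 hc2 hd2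
  rcases hc2 with h | h
  · simp [h] at hc0
  · simp [h] at hd2

/-! ### The qubit case -/

theorem dissipator_smul_one (c : ℂ) :
    dissipator (c • (1 : Matrix (Fin n) (Fin n) ℂ)) = 0 := by
  ext1 ρ
  simp [dissipator, smul_smul, ← two_smul ℂ, mul_comm]

theorem eq_smul_one_of_offDiag_eq_zero (V : Matrix (Fin 2) (Fin 2) ℂ)
    (h : ∀ U ∈ Matrix.specialUnitaryGroup (Fin 2) ℂ, ∀ i j, i ≠ j → (Uᴴ * V * U) i j = 0) :
    V = V 0 0 • 1 := by
  have h01 : V 0 1 = 0 := by simpa using h 1 (one_mem _) 0 1 (by simp)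
  have h10 : V 1 0 = 0 := by simpa using h 1 (one_mem _) 1 0 (by simp)
  -- For diagonal `V` this rational rotation produces the off-diagonal entry `12/25 * (V 1 1 - V 0
  -- 0)`.
  have hrot : (!![3 / 5, -(4 / 5); 4 / 5, 3 / 5] : Matrix (Fin 2) (Fin 2) ℂ) ∈
      Matrix.specialUnitaryGroup (Fin 2) ℂ := by
    rw [Matrix.mem_specialUnitaryGroup_iff, Matrix.mem_unitaryGroup_iff',
      Matrix.star_eq_conjTranspose]
    constructor
    · ext i j
      fin_cases i <;> fin_cases j <;> simp [Matrix.mul_apply, Fin.sum_univ_two, map_ofNat] <;> norm_num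
    · rw [Matrix.det_fin_two_of]
      norm_num
  have h11 := h _ hrot 0 1 (by simp)
  simp [Matrix.mul_apply, Fin.sum_univ_two, h01, h10, map_ofNat] at h11
  have h11' : V 1 1 = V 0 0 := by linear_combination (25 / 12) * h11
  ext i j
  fin_cases i <;> fin_cases j <;> simp [h01, h10, h11']

theorem generically_iff_of_two (H : Matrix (Fin 2) (Fin 2) ℂ) (hH : H.IsHermitian)
    (V : Fin r → Matrix (Fin 2) (Fin 2) ℂ) :
    GenericallyDirectlyAccessible (lindblad H V) ↔ ¬ IsPurelyHamiltonian (lindblad H V) := by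
  constructor
  · rintro hG ⟨K, -, hK⟩
    obtain ⟨x, hx⟩ := HoldsGenerically.exists two_ne_zero hG
    rw [directlyAccessibleAt_iff] at hx
    have hz := hx ![1, -1] (by simp)
    have hbot : Submodule.span ℝ (derv (lindblad H V) x) = ⊥ := by
      rw [Submodule.span_eq_bot]
      rintro _ ⟨U, hU, rfl⟩
      ext i
      simp [hK, inducedField, adMap_conj_diag K (conjTranspose_mul_self_of_mem hU)]
    rw [hbot, Submodule.mem_bot] at hz
    simpa using congrFun hz 0
  · intro hP
    by_cases hJ : ∃ U ∈ Matrix.specialUnitaryGroup (Fin 2) ℂ, ∃ i j, i ≠ j ∧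
        rateMatrix V U i j ≠ 0
    · obtain ⟨U, hU, i, j, hij, hJ⟩ := hJ
      refine GenericallyDirectlyAccessible.of_directlyAccessibleAt H V
        (single_mem_stdSimplex ℝ j) ?_
      rw [directlyAccessibleAt_iff]
      intro z hz
      set v := inducedField (lindblad H V) U (Pi.single j 1) with hv
      have hvi : v i ≠ 0 := by rwa [hv, inducedField_single H V hU hij]
      have hvs := sum_inducedField H V hU (Pi.single j 1)
      rw [← hv] at hvs
      have huniv : (univ : Finset (Fin 2)) = {i, j} := by
        symm
        rw [← card_eq_iff_eq_univ, card_pair hij, Fintype.card_fin]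
      rw [huniv, sum_pair hij] at hz hvs
      have hzv : z = (z i / v i) • v := by
        ext k
        have hk : k ∈ ({i, j} : Finset (Fin 2)) := huniv ▸ mem_univ k
        rw [mem_insert, mem_singleton] at hk
        rw [Pi.smul_apply, smul_eq_mul]
        rcases hk with rfl | rfl
        · field_simp
        · field_simp
          linear_combination v i * hz - z i * hvs
      rw [hzv]
      exact Submodule.smul_mem _ _ (Submodule.subset_span ⟨U, hU, rfl⟩)
    · push Not at hJ
      refine (hP ⟨H, hH, ?_⟩).elim
      have hV : ∀ k, dissipator (V k) = 0 := by
        intro k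
        rw [eq_smul_one_of_offDiag_eq_zero (V k) fun U hU i j hij => ?_]
        · exact dissipator_smul_one _
        · have h := hJ U hU i j hij
          simp only [rateMatrix, Matrix.of_apply] at h
          rw [sum_eq_zero_iff_of_nonneg fun _ _ => by positivity] at h
          simpa using h k (mem_univ k)
      simp [lindblad, hV]

end GKSL

theorem mainTheorem8 (n r : ℕ) (H₀ : Matrix (Fin n) (Fin n) ℂ) (hH₀ : H₀.IsHermitian)
    (V : Fin r → Matrix (Fin n) (Fin n) ℂ)
    (hL : GKSL.IsUnital (GKSL.lindblad H₀ V)) :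
    (n = 2 →
      (GKSL.GenericallyDirectlyAccessible (GKSL.lindblad H₀ V) ↔
        ¬ GKSL.IsPurelyHamiltonian (GKSL.lindblad H₀ V))) ∧
    (2 < n →
      Xor (GKSL.GenericallyDirectlyAccessible (GKSL.lindblad H₀ V))
        (GKSL.NowhereDirectlyAccessible (GKSL.lindblad H₀ V) ∧
          ∀ U ∈ Matrix.specialUnitaryGroup (Fin n) ℂ,
            GKSL.HasIdenticalOffDiagonal (GKSL.rateMatrix V U))) := by
  refine ⟨?_, fun hn => ?_⟩
  · rintro rfl
    exact GKSL.generically_iff_of_two H₀ hH₀ V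
  -- The dichotomy: does some column of some `J(U)` have two different off-diagonal entries? If so,
  -- the vertex `e_j` gives generic accessibility and also refutes the second alternative.
  · by_cases hJ : ∃ U ∈ Matrix.specialUnitaryGroup (Fin n) ℂ, ∃ i j k, i ≠ j ∧ k ≠ j ∧
        GKSL.rateMatrix V U i j ≠ GKSL.rateMatrix V U k j
    · obtain ⟨U, hU, i, j, k, hij, hkj, hik⟩ := hJ
      have hp := single_mem_stdSimplex ℝ j
      have hD := GKSL.directlyAccessibleAt_single_of_rateMatrix_ne H₀ V hU hij hkj hik
      exact Or.inl ⟨GKSL.GenericallyDirectlyAccessible.of_directlyAccessibleAt H₀ V hp hD,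
        fun h => h.1 _ hp hD⟩
    · push Not at hJ
      have hI : ∀ U ∈ Matrix.specialUnitaryGroup (Fin n) ℂ,
          GKSL.HasIdenticalOffDiagonal (GKSL.rateMatrix V U) := fun U hU =>
        GKSL.hasIdenticalOffDiagonal_of_columns (hJ U hU)
          (GKSL.sum_rateMatrix_comm_of_isUnital H₀ V hL hU)
      have hnot := GKSL.not_directlyAccessibleAt_of_hasIdenticalOffDiagonal hn H₀ V hI
      refine Or.inr ⟨⟨fun x _ => hnot x, hI⟩, fun hG => ?_⟩
      obtain ⟨x, hx⟩ := GKSL.HoldsGenerically.exists (by omega) hG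
      exact hnot _ hx
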